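/- Let $V$ be a set, $w:V\to\mathbb{R}_{>0}$ a weight function and $q\in\mathbb{R}$ a quota; for a finite set $F\subseteq V$ write $w(F)=\sum_{v\in F}w(v)$. Let $X=X[w:q]$ be the scalar quota complex, i.e. the simplicial complex whose faces are the nonempty finite sets $F\subseteq V$ with $w(F)<q$. Suppose that $X$ has only finitely many faces, and let $v_{\min}$ be a vertex of $X$ whose weight is minimal among the vertices of $X$. Let $|X|$ be the underlying topological space of $X$, let $A=\overline{\mathrm{St}}(v_{\min})\subseteq|X|$ be the closed star of $v_{\min}$, that is, the union of all closed faces of $X$ that contain $v_{\min}$, and let $|X|/A$ be the quotient space obtained by collapsing $A$ to a point. Then: 1. The quotient map $\pi:|X|\to|X|/A$ is a homotopy equivalence. 2. $|X|/A$ is a bouquet of spheres with one $i$-sphere for each $i$-face $F$ of $X$ such that $v_{\min}\notin F$ and $q-w(v_{\min})\le w(F)<q$. That is, $|X|/A$ is homeomorphic to the wedge $\bigvee_F S^{\dim F}$ over all such faces $F$ (where $\dim F=|F|-1$, $0$-spheres are allowed, and the empty wedge is a point), by a homeomorphism that sends the point $A/A$ to the wedge point. 3. For every integer $i\ge 0$,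 the reduced simplicial homology group $\tilde H_i(X)$ with integer coefficients is a free abelian group of finite rank, equal to the number of $i$-faces $F$ of $X$ with $v_{\min}\notin F$ and $q-w(v_{\min})\le w(F)<q$. -/

import Mathlib

noncomputable section

namespace Quota

/-! ### Scalar quota complexes -/

/-- The weight `w(F) = ∑ v ∈ F, w v` of a finite set of vertices. -/
def weight {V : Type*} (w : V → ℝ) (F : Finset V) : ℝ := ∑ v ∈ F, w v

/-- The scalar quota complex `X[w : q]`: its faces are the nonempty finite sets of vertices of
total weight less than the quota `q`. -/
def quotaComplex {V : Type*} (w : V → ℝ) (q : ℝ) (hw : ∀ v, 0 < w v) :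
    PreAbstractSimplicialComplex V where
  faces := {F | F.Nonempty ∧ weight w F < q}
  isRelLowerSet_faces := fun _ hF =>
    ⟨hF.1, fun _ hG hne =>
      ⟨hne, (Finset.sum_le_sum_of_subset_of_nonneg hG fun v _ _ => (hw v).le).trans_lt hF.2⟩⟩

/-- The shell faces with respect to the vertex `v₀`: the faces `F` of `X[w : q]` not containing
`v₀` with `q - w(v₀) ≤ w(F) < q`. -/
def shellFaces {V : Type*} (w : V → ℝ) (q : ℝ) (hw : ∀ v, 0 < w v) (v₀ : V) : Set (Finset V) :=
  {F | F ∈ (quotaComplex w q hw).faces ∧ v₀ ∉ F ∧ q - w v₀ ≤ weight w F ∧ weight w F < q}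

/-! ### The underlying space of a simplicial complex -/

/-- The underlying space `|X|` in barycentric coordinates, as a subspace of `V → ℝ`. For a complex
with finitely many faces this is the usual topology of `|X|`. -/
def realization {V : Type*} (X : PreAbstractSimplicialComplex V) : Set (V → ℝ) :=
  {x | (∀ v, 0 ≤ x v) ∧ ∃ F ∈ X.faces, (∀ v, v ∉ F → x v = 0) ∧ ∑ v ∈ F, x v = 1}

/-- The closed star of `v₀`: the union of all closed faces of `X` that contain `v₀`. -/
def closedStar {V : Type*} (X : PreAbstractSimplicialComplex V) (v₀ : V) : Set (realization X) :=
  {x | ∃ F ∈ X.faces, v₀ ∈ F ∧ ∀ v, v ∉ F → (x : V → ℝ) v = 0}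

/-! ### Collapsing a subspace, and bouquets of spheres -/

/-- The equivalence relation on `Y` that identifies all the points of `A`. -/
def collapseSetoid {Y : Type*} (A : Set Y) : Setoid Y where
  r x y := x = y ∨ (x ∈ A ∧ y ∈ A)
  iseqv :=
    { refl := fun _ => Or.inl rfl
      symm := by
        rintro x y (h | h)
        · exact Or.inl h.symm
        · exact Or.inr h.symm
      trans := by
        rintro x y z (rfl | h) (rfl | k)
        · exact Or.inl rfl
        · exact Or.inr k
        · exact Or.inr h
        · exact Or.inr ⟨h.1, k.2⟩ }

/-- The space `Y / A`, for nonempty `A`, with the quotient topology. -/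
abbrev Collapse {Y : Type*} (A : Set Y) : Type _ := Quotient (collapseSetoid A)

/-- The quotient map `π : Y → Y / A`. -/
def collapseMap {Y : Type*} (A : Set Y) (y : Y) : Collapse A := Quotient.mk (collapseSetoid A) y

/-- The unit sphere `S^n` of `ℝ^(n+1)`. -/
abbrev Sphere (n : ℕ) : Type := Metric.sphere (0 : EuclideanSpace ℝ (Fin (n + 1))) 1

/-- The base point `(1, 0, …, 0)` of `S^n`. -/
def sphereBase (n : ℕ) : Sphere n := ⟨EuclideanSpace.single 0 1, by simp⟩

/-- The points of the disjoint union of a point and the spheres `S^(d j)`, `j : J`, that are glued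
together in the bouquet: the extra point and the base points of the spheres. The extra point makes
the empty bouquet a point. -/
def basePoints {J : Type*} (d : J → ℕ) : Set (Unit ⊕ (Σ j : J, Sphere (d j))) :=
  {p | p = Sum.inl () ∨ ∃ j : J, p = Sum.inr ⟨j, sphereBase (d j)⟩}

/-- The bouquet (wedge) of the spheres `S^(d j)`, `j : J`. -/
abbrev Bouquet {J : Type*} (d : J → ℕ) : Type _ := Collapse (basePoints d)

/-- The wedge point. -/
def Bouquet.base {J : Type*} (d : J → ℕ) : Bouquet d := collapseMap (basePoints d) (Sum.inl ())

/-! ### Reduced simplicial homology with integer coefficients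

A linear order on the vertices orients the simplices. A simplex of dimension `i` is a face with
`i + 1` vertices; the empty simplex, of dimension `-1`, gives the augmentation. -/

/-- The simplicial boundary `∂[v₀, …, vₙ] = ∑ i, (-1)^i [v₀, …, v̂ᵢ, …, vₙ]`, `v₀ < ⋯ < vₙ`, on the
free abelian group on all finite sets of vertices; here `i` is the number of `u ∈ F` with
`u < vᵢ`. -/
def boundary (V : Type*) [LinearOrder V] : (Finset V →₀ ℤ) →ₗ[ℤ] (Finset V →₀ ℤ) :=
  Finsupp.linearCombination ℤ fun F : Finset V =>
    ∑ v ∈ F, Finsupp.single (F.erase v) ((-1 : ℤ) ^ (F.filter (· < v)).card)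

/-- The augmented simplicial chains of `X` on simplices with `n` vertices
(that is, of dimension `n - 1`). -/
def chains {V : Type*} (X : PreAbstractSimplicialComplex V) (n : ℕ) :
    Submodule ℤ (Finset V →₀ ℤ) :=
  Finsupp.supported ℤ ℤ {F | (F = ∅ ∨ F ∈ X.faces) ∧ F.card = n}

/-- The reduced `i`-cycles. -/
def reducedCycles {V : Type*} [LinearOrder V] (X : PreAbstractSimplicialComplex V) (i : ℕ) :
    Submodule ℤ (Finset V →₀ ℤ) :=
  chains X (i + 1) ⊓ LinearMap.ker (boundary V)

/-- The `i`-boundaries. -/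
def boundaries {V : Type*} [LinearOrder V] (X : PreAbstractSimplicialComplex V) (i : ℕ) :
    Submodule ℤ (Finset V →₀ ℤ) :=
  (chains X (i + 2)).map (boundary V)

theorem boundary_single {V : Type*} [LinearOrder V] (F : Finset V) (a : ℤ) :
    boundary V (Finsupp.single F a) =
      a • ∑ v ∈ F, Finsupp.single (F.erase v) ((-1 : ℤ) ^ (F.filter (· < v)).card) := by
  simp [boundary, Finsupp.linearCombination_single]

theorem boundary_boundary {V : Type*} [LinearOrder V] (c : Finset V →₀ ℤ) :
    boundary V (boundary V c) = 0 := by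
  induction c using Finsupp.induction_linear with
  | zero => simp
  | add f g hf hg => simp [hf, hg]
  | single F a =>
    rw [boundary_single, map_smul, map_sum]
    simp only [boundary_single, Finset.smul_sum]
    rw [Finset.sum_sigma']
    refine Finset.sum_involution (fun p _ => ⟨p.2, p.1⟩) ?_ ?_ ?_ ?_
    · rintro ⟨v, u⟩ h
      simp only [Finset.mem_sigma, Finset.mem_erase] at h
      obtain ⟨hv, huv, hu⟩ := h
      have key : ∀ x y : V, x ∈ F → y ∈ F → x < y →
          (F.filter (· < y)).card = ((F.erase x).filter (· < y)).card + 1 ∧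
          (F.erase y).filter (· < x) = F.filter (· < x) := by
        intro x y hx hy hxy
        refine ⟨?_, ?_⟩
        · rw [Finset.filter_erase, Finset.card_erase_add_one (by simp [hx, hxy])]
        · rw [Finset.filter_erase, Finset.erase_eq_of_notMem (by simp [hxy.le])]
      have hcomm : (F.erase v).erase u = (F.erase u).erase v := Finset.erase_right_comm
      rcases lt_or_gt_of_ne huv with hlt | hlt
      · obtain ⟨h1, h2⟩ := key u v hu hv hlt
        simp only [hcomm, h1, h2, Finsupp.smul_single, smul_eq_mul, ← Finsupp.single_add]
        refine (congrArg _ ?_).trans (Finsupp.single_zero _)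
        ring
      · obtain ⟨h1, h2⟩ := key v u hv hu hlt
        simp only [hcomm, h1, h2, Finsupp.smul_single, smul_eq_mul, ← Finsupp.single_add]
        refine (congrArg _ ?_).trans (Finsupp.single_zero _)
        ring
    · rintro ⟨v, u⟩ h _ heq
      simp only [Finset.mem_sigma, Finset.mem_erase] at h
      exact h.2.1 (by simpa using (Sigma.mk.inj heq).1)
    · rintro ⟨v, u⟩ h
      simp only [Finset.mem_sigma, Finset.mem_erase] at h ⊢
      exact ⟨h.2.2, h.2.1.symm, h.1⟩
    · rintro ⟨v, u⟩ _
      rfl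

/-- The reduced simplicial homology group `H̃_i(X)` with integer coefficients. -/
abbrev ReducedHomology {V : Type*} [LinearOrder V] (X : PreAbstractSimplicialComplex V) (i : ℕ) :
    Type _ :=
  reducedCycles X i ⧸ (boundaries X i).submoduleOf (reducedCycles X i)

/-- Boundaries are cycles, so that the quotient above is the quotient by all the boundaries. -/
theorem boundaries_le_reducedCycles {V : Type*} [LinearOrder V]
    (X : PreAbstractSimplicialComplex V) (i : ℕ) : boundaries X i ≤ reducedCycles X i := by
  rintro _ ⟨c, hc, rfl⟩
  refine ⟨?_, boundary_boundary c⟩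
  have hc' : c ∈ Finsupp.supported ℤ ℤ {F | (F = ∅ ∨ F ∈ X.faces) ∧ F.card = i + 2} := hc
  rw [Finsupp.supported_eq_span_single] at hc'
  induction hc' using Submodule.span_induction with
  | zero => simp
  | add x y hx hy hx' hy' =>
    rw [map_add]
    refine add_mem (hx' ?_) (hy' ?_)
    · rw [← Finsupp.supported_eq_span_single] at hx; exact hx
    · rw [← Finsupp.supported_eq_span_single] at hy; exact hy
  | smul a x hx hx' =>
    rw [map_smul]
    refine Submodule.smul_mem _ _ (hx' ?_)
    rw [← Finsupp.supported_eq_span_single] at hx; exact hx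
  | mem x hx =>
    obtain ⟨F, ⟨hF, hcard⟩, rfl⟩ := hx
    simp only [boundary_single, one_smul]
    refine Submodule.sum_mem _ fun v hv => Finsupp.single_mem_supported ℤ _ ?_
    have hc2 : (F.erase v).card = i + 1 := by rw [Finset.card_erase_of_mem hv, hcard]; rfl
    refine ⟨Or.inr ?_, hc2⟩
    rcases hF with rfl | hF
    · simp at hv
    · exact (X.isRelLowerSet_faces hF).2 (Finset.erase_subset v F)
        (Finset.card_pos.mp (by omega))

end Quota

end

/-!
Let `A` be the closed star of `v₀ = vmin`. The faces of `X` outside `A` are the shell faces.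
Removing from a shell face a vertex, which is at least as heavy as `v₀`, makes room for `v₀`; so the
boundary of a shell face lies in `A`, and shell faces are maximal (`isShell_shellFaces`,
`IsShell.eq_of_subset`). Hence `|X|` is `A` with the shell faces attached along their boundaries,
and a point outside `A` is interior to a unique shell face. Nothing else about the weights is used.

* The closed star is a cone, so it contracts to `v₀` within itself. The explicit deformation
  `coneDeform` extends this contraction over the shell faces: a shell face is expanded from its
  barycentre, and what is pushed out across its boundary follows the contraction of `A`. The inverse
  of the quotient map is induced by the end of this deformation
  (`exists_homotopyEquiv_collapse`).
* Each shell face `F` gives a map `|X| → S ^ dim F` that collapses the complement of its interior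
  (`faceToSphere`, built on `simplexToSphere`). Together they map `|X|` to the product of the
  spheres, with `A` as the only nontrivial fibre, and onto the points with at most one coordinate
  different from the base point. The bouquet embeds in the product with the same image. Both
  quotients are compact and the product is Hausdorff, so they are homeomorphic
  (`exists_homeomorph_bouquet`).
* Taking the coefficients at the shell `i`-faces maps the `i`-cycles to a free group. Boundaries are
  sent to `0` because shell faces are maximal. A cycle in `A` bounds its cone with apex `v₀`
  (`boundary_coneOperator_add`), so the kernel consists of boundaries. The map is onto because a
  shell face minus the cone over its boundary is a cycle (`exists_cycle`).
-/

/-! ### Faces outside the closed star -/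

namespace Quota

/-- `G` spans, together with `v₀`, a face of `X`: the closed simplex on `G` lies in the closed star
of `v₀`. The empty set is allowed, and is such a `G` as soon as `v₀` is a vertex. -/
def IsStarFace {V : Type*} (X : PreAbstractSimplicialComplex V) (v₀ : V) (G : Finset V) : Prop :=
  ∃ H ∈ X.faces, v₀ ∈ H ∧ G ⊆ H

/-- `S` is the set of the faces of `X` outside the closed star of `v₀`, and the boundaries of these
faces lie in the closed star. -/
structure IsShell {V : Type*} (X : PreAbstractSimplicialComplex V) (v₀ : V)
    (S : Set (Finset V)) : Prop where
  mem_iff : ∀ F, F ∈ S ↔ F ∈ X.faces ∧ ¬ IsStarFace X v₀ F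
  isStarFace_of_ssubset : ∀ F ∈ S, ∀ G, G ⊂ F → IsStarFace X v₀ G

variable {V : Type*} {X : PreAbstractSimplicialComplex V} {v₀ : V} {S : Set (Finset V)}

theorem IsStarFace.mono {F G : Finset V} (h : IsStarFace X v₀ G) (hFG : F ⊆ G) :
    IsStarFace X v₀ F := by
  obtain ⟨H, hH, hv, hG⟩ := h
  exact ⟨H, hH, hv, hFG.trans hG⟩

theorem IsStarFace.insert_mem [DecidableEq V] {F : Finset V} (h : IsStarFace X v₀ F) :
    insert v₀ F ∈ X.faces := by
  obtain ⟨H, hH, hv, hG⟩ := h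
  exact (X.isRelLowerSet_faces hH).2 (Finset.insert_subset hv hG) (Finset.insert_nonempty _ _)

theorem nonempty_of_mem_faces {F : Finset V} (hF : F ∈ X.faces) : F.Nonempty :=
  (X.isRelLowerSet_faces hF).1

namespace IsShell

theorem mem_faces (hS : IsShell X v₀ S) {F : Finset V} (hF : F ∈ S) : F ∈ X.faces :=
  ((hS.mem_iff F).1 hF).1

theorem not_isStarFace (hS : IsShell X v₀ S) {F : Finset V} (hF : F ∈ S) : ¬ IsStarFace X v₀ F :=
  ((hS.mem_iff F).1 hF).2

theorem nonempty (hS : IsShell X v₀ S) {F : Finset V} (hF : F ∈ S) : F.Nonempty :=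
  nonempty_of_mem_faces (hS.mem_faces hF)

/-- Faces outside the closed star are maximal faces. -/
theorem eq_of_subset (hS : IsShell X v₀ S) {F G : Finset V} (hF : F ∈ S) (hG : G ∈ X.faces)
    (h : F ⊆ G) : F = G := by
  by_contra hne
  have hGs : ¬ IsStarFace X v₀ G := fun hs => hS.not_isStarFace hF (hs.mono h)
  exact hS.not_isStarFace hF
    (hS.isStarFace_of_ssubset G ((hS.mem_iff G).2 ⟨hG, hGs⟩) F (h.ssubset_of_ne hne))

end IsShell

/-- The only place where the weights enter: removing from a shell face a vertex, which weighs at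
least `w v₀`, makes room for `v₀`. -/
theorem isShell_shellFaces (w : V → ℝ) (q : ℝ) (hw : ∀ v, 0 < w v) (v₀ : V)
    (hmin : ∀ v, {v} ∈ (quotaComplex w q hw).faces → w v₀ ≤ w v) :
    IsShell (quotaComplex w q hw) v₀ (shellFaces w q hw v₀) := by
  classical
  have hmono : ∀ F G : Finset V, F ⊆ G → weight w F ≤ weight w G := fun F G h =>
    Finset.sum_le_sum_of_subset_of_nonneg h fun v _ _ => (hw v).le
  have hins : ∀ F : Finset V, v₀ ∉ F → weight w (insert v₀ F) = w v₀ + weight w F := fun F h =>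
    Finset.sum_insert h
  refine ⟨fun F => ?_, fun F hF G hG => ?_⟩
  · constructor
    · rintro ⟨hF, hv, hle, -⟩
      refine ⟨hF, ?_⟩
      intro hs
      have := hs.insert_mem.2
      rw [hins F hv] at this
      linarith
    · rintro ⟨hF, hs⟩
      have hv : v₀ ∉ F := fun hv => hs ⟨F, hF, hv, subset_rfl⟩
      refine ⟨hF, hv, ?_, hF.2⟩
      by_contra hlt
      refine hs ⟨insert v₀ F, ⟨Finset.insert_nonempty _ _, ?_⟩, Finset.mem_insert_self _ _,
        Finset.subset_insert _ _⟩
      rw [hins F hv]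
      linarith
  · obtain ⟨hFX, hv, -, hlt⟩ := hF
    obtain ⟨u, huF, huG⟩ := Finset.exists_of_ssubset hG
    have hvG : v₀ ∉ G := fun h => hv (hG.1 h)
    refine ⟨insert v₀ G, ⟨Finset.insert_nonempty _ _, ?_⟩, Finset.mem_insert_self _ _,
      Finset.subset_insert _ _⟩
    have hu : w v₀ ≤ w u := hmin u ((quotaComplex w q hw).isRelLowerSet_faces hFX |>.2
      (Finset.singleton_subset_iff.2 huF) (Finset.singleton_nonempty u))
    have h1 := hmono (insert u G) F (Finset.insert_subset huF hG.1)
    rw [show weight w (insert u G) = w u + weight w G from Finset.sum_insert huG] at h1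
    rw [hins G hvG]
    linarith

/-! ### Points of the underlying space -/

theorem mem_realization_of_sum_eq_one {y : V → ℝ} (hy : ∀ v, 0 ≤ y v) {G : Finset V}
    (hG : G ∈ X.faces) (hyG : ∀ v, v ∉ G → y v = 0) {K : Finset V} (hyK : ∀ v, v ∉ K → y v = 0)
    (hsum : ∑ v ∈ K, y v = 1) : y ∈ realization X := by
  classical
  refine ⟨hy, G, hG, hyG, ?_⟩
  rw [← hsum, Finset.sum_subset (Finset.subset_union_left : G ⊆ G ∪ K) fun v _ hv => hyG v hv,
    Finset.sum_subset (Finset.subset_union_right : K ⊆ G ∪ K) fun v _ hv => hyK v hv]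

/-- A point outside the closed star is interior to a face outside the closed star. -/
theorem mem_closedStar_or_exists_interior (hS : IsShell X v₀ S) (x : realization X) :
    x ∈ closedStar X v₀ ∨ ∃ F ∈ S, (∀ v ∈ F, 0 < (x : V → ℝ) v) ∧
      (∀ v, v ∉ F → (x : V → ℝ) v = 0) ∧ ∑ v ∈ F, (x : V → ℝ) v = 1 := by
  classical
  obtain ⟨x, hx, F, hF, hxF, hsum⟩ := x
  set G := F.filter (fun v => x v ≠ 0) with hGdef
  have hGsum : ∑ v ∈ G, x v = 1 := by rw [← hsum, hGdef, Finset.sum_filter_ne_zero]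
  have hGne : G.Nonempty := by
    rw [Finset.nonempty_iff_ne_empty]
    intro h
    simp [h] at hGsum
  have hG : G ∈ X.faces := (X.isRelLowerSet_faces hF).2 (Finset.filter_subset _ _) hGne
  have hxG : ∀ v, v ∉ G → x v = 0 := by
    intro v hv
    by_contra h
    exact hv (Finset.mem_filter.2 ⟨by_contra fun h' => h (hxF v h'), h⟩)
  by_cases hs : IsStarFace X v₀ G
  · obtain ⟨H, hH, hv, hGH⟩ := hs
    exact Or.inl ⟨H, hH, hv, fun v hv => hxG v fun h => hv (hGH h)⟩
  · refine Or.inr ⟨G, (hS.mem_iff G).2 ⟨hG, hs⟩, fun v hv => ?_, hxG, hGsum⟩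
    exact lt_of_le_of_ne (hx v) (Ne.symm (Finset.mem_filter.1 hv).2)

theorem sum_eq_one_of_support {x : V → ℝ} (hx : x ∈ realization X) {K : Finset V}
    (hK : ∀ v, v ∉ K → x v = 0) : ∑ v ∈ K, x v = 1 := by
  classical
  obtain ⟨-, F, -, hxF, hsum⟩ := hx
  rw [← hsum, Finset.sum_subset (Finset.subset_union_left : F ⊆ F ∪ K) fun v _ hv => hxF v hv,
    Finset.sum_subset (Finset.subset_union_right : K ⊆ F ∪ K) fun v _ hv => hK v hv]

/-- A face outside the closed star on which `x` is positive carries `x`. -/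
theorem support_subset_of_pos (hS : IsShell X v₀ S) {F : Finset V} (hF : F ∈ S)
    {x : realization X} (hpos : ∀ v ∈ F, 0 < (x : V → ℝ) v) :
    ∀ v, v ∉ F → (x : V → ℝ) v = 0 := by
  obtain ⟨-, G, hG, hxG, -⟩ := x.2
  have hFG : F ⊆ G := fun v hv => by_contra fun h => (hpos v hv).ne' (hxG v h)
  rw [hS.eq_of_subset hF hG hFG]
  exact hxG

theorem notMem_closedStar_of_pos (hS : IsShell X v₀ S) {F : Finset V} (hF : F ∈ S)
    {x : realization X} (hpos : ∀ v ∈ F, 0 < (x : V → ℝ) v) : x ∉ closedStar X v₀ := by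
  rintro ⟨G, hG, hv, hxG⟩
  exact hS.not_isStarFace hF
    ⟨G, hG, hv, fun v hv => by_contra fun h => (hpos v hv).ne' (hxG v h)⟩

theorem eq_of_pos_of_support (hS : IsShell X v₀ S) {F G : Finset V} (hF : F ∈ S)
    (hG : G ∈ S) {x : V → ℝ} (hpos : ∀ v ∈ G, 0 < x v) (hx : ∀ v, v ∉ F → x v = 0) : G = F :=
  hS.eq_of_subset hG (hS.mem_faces hF)
    fun v hv => by_contra fun h => (hpos v hv).ne' (hx v h)

theorem isCompact_realization (hfin : X.faces.Finite) : IsCompact (realization X) := by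
  have h : realization X = ⋃ F ∈ X.faces,
      {x : V → ℝ | (∀ v, 0 ≤ x v) ∧ (∀ v, v ∉ F → x v = 0) ∧ ∑ v ∈ F, x v = 1} := by
    ext x
    simp only [realization, Set.mem_ofPred_eq, Set.mem_iUnion, exists_prop]
    tauto
  rw [h]
  refine hfin.isCompact_biUnion fun F _ => ?_
  refine (isCompact_univ_pi fun _ : V => isCompact_Icc (a := (0 : ℝ)) (b := 1)).of_isClosed_subset
    ?_ ?_
  · simp only [Set.ofPred_and, Set.ofPred_forall]
    refine (isClosed_iInter fun v => isClosed_le continuous_const (continuous_apply v)).inter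
      ((isClosed_iInter fun v => isClosed_iInter fun _ =>
        isClosed_eq (continuous_apply v) continuous_const).inter
      (isClosed_eq (continuous_finsetSum _ fun v _ => continuous_apply v) continuous_const))
  · rintro x ⟨h0, hF, hsum⟩ v -
    refine ⟨h0 v, ?_⟩
    by_cases hv : v ∈ F
    · rw [← hsum]
      exact Finset.single_le_sum (fun u _ => h0 u) hv
    · rw [hF v hv]
      exact zero_le_one

/-- The vertex `v₀`, as a point of the underlying space. -/
theorem exists_mem_closedStar (hv : {v₀} ∈ X.faces) : ∃ x, x ∈ closedStar X v₀ := by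
  classical
  refine ⟨⟨Pi.single v₀ 1, fun v => ?_, {v₀}, hv, fun v h => ?_, by simp⟩, {v₀}, hv, by simp,
    fun v h => ?_⟩
  · by_cases h : v = v₀
    · subst h; simp
    · simp [h]
  · simp only [Finset.mem_singleton] at h
    simp [h]
  · simp only [Finset.mem_singleton] at h
    simp [h]

end Quota

/-! ### Collapsing a subspace that deforms to a point -/

namespace Quota

theorem continuous_collapseMap {Y : Type*} [TopologicalSpace Y] (A : Set Y) :
    Continuous (collapseMap A) := continuous_quotient_mk'

theorem collapseMap_eq_iff {Y : Type*} (A : Set Y) {x y : Y} :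
    collapseMap A x = collapseMap A y ↔ x = y ∨ (x ∈ A ∧ y ∈ A) :=
  Quotient.eq (r := collapseSetoid A)

/-- If a homotopy from the identity of `Y` maps `A` to itself at all times, and maps `A` to a point
at time `1`, then it induces on `Y / A` a homotopy from the identity to a map that factors through
`Y`. -/
theorem exists_homotopyEquiv_collapse {Y : Type*} [TopologicalSpace Y] (A : Set Y)
    (H : unitInterval × Y → Y) (hH : Continuous H) (h0 : ∀ y, H (0, y) = y)
    (hA : ∀ t, ∀ y ∈ A, H (t, y) ∈ A) (h1 : ∀ y ∈ A, ∀ z ∈ A, H (1, y) = H (1, z)) :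
    ∃ e : ContinuousMap.HomotopyEquiv Y (Collapse A), ∀ x, e x = collapseMap A x := by
  have hq : Topology.IsQuotientMap (collapseMap A) := isQuotientMap_quotient_mk'
  let p : C(Y, Collapse A) := ⟨collapseMap A, continuous_collapseMap A⟩
  have hf : Continuous fun y => H (1, y) := hH.comp (by fun_prop)
  let g : C(Collapse A, Y) := ⟨Quotient.lift (fun y => H (1, y)) (by
    rintro a b (rfl | ⟨ha, hb⟩)
    · rfl
    · exact h1 a ha b hb), hf.quotient_lift _⟩
  let K : unitInterval × Collapse A → Collapse A := fun z =>
    Quotient.lift (fun y => collapseMap A (H (z.1, y))) (by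
      rintro a b (rfl | ⟨ha, hb⟩)
      · rfl
      · exact (collapseMap_eq_iff A).2 (Or.inr ⟨hA _ a ha, hA _ b hb⟩)) z.2
  have hK : Continuous K :=
    hq.continuous_lift_prod_right (g := K) ((continuous_collapseMap A).comp hH)
  refine ⟨⟨p, g, ?_, ?_⟩, fun x => rfl⟩
  · exact (ContinuousMap.Homotopic.symm ⟨⟨⟨H, hH⟩, h0, fun _ => rfl⟩⟩)
  · refine ContinuousMap.Homotopic.symm ⟨⟨⟨K, hK⟩, fun y => ?_, fun y => ?_⟩⟩
    · obtain ⟨y, rfl⟩ := hq.surjective y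
      exact congrArg (collapseMap A) (h0 y)
    · obtain ⟨y, rfl⟩ := hq.surjective y
      rfl

/-! ### The least barycentric coordinate on a face -/

theorem continuous_iInf_of_finite {ι : Type*} [Finite ι] [Nonempty ι] :
    Continuous fun x : ι → ℝ => ⨅ i, x i := by
  cases nonempty_fintype ι
  simp_rw [← Finset.inf'_univ_eq_ciInf]
  exact Continuous.finset_inf'_apply _ fun i _ => continuous_apply i

variable {V : Type*} {X : PreAbstractSimplicialComplex V} {v₀ : V} {T : Finset (Finset V)}

/-- The least of the coordinates of `x` at the vertices of `F`. -/
noncomputable def faceMin (F : Finset V) (x : V → ℝ) : ℝ := ⨅ v : F, x v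

theorem faceMin_le {F : Finset V} (x : V → ℝ) {v : V} (hv : v ∈ F) : faceMin F x ≤ x v :=
  ciInf_le (Set.finite_range fun v : F => x v).bddBelow ⟨v, hv⟩

theorem exists_eq_faceMin {F : Finset V} (hF : F.Nonempty) (x : V → ℝ) :
    ∃ v ∈ F, x v = faceMin F x := by
  have : Nonempty F := hF.to_subtype
  obtain ⟨v, hv⟩ := exists_eq_ciInf_of_finite (f := fun v : F => x v)
  exact ⟨v, v.2, hv⟩

theorem continuous_faceMin {F : Finset V} (hF : F.Nonempty) : Continuous (faceMin F) := by
  have : Nonempty F := hF.to_subtype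
  exact continuous_iInf_of_finite.comp (by fun_prop : Continuous fun (x : V → ℝ) (v : F) => x v)

theorem faceMin_nonneg {F : Finset V} {x : V → ℝ} (hx : ∀ v, 0 ≤ x v) : 0 ≤ faceMin F x :=
  Real.iInf_nonneg fun v => hx v

theorem faceMin_eq_zero_or_pos {F : Finset V} {x : V → ℝ} (hx : ∀ v, 0 ≤ x v) :
    faceMin F x = 0 ∨ ∀ v ∈ F, 0 < x v := by
  rcases (faceMin_nonneg hx).eq_or_lt with h | h
  · exact Or.inl h.symm
  · exact Or.inr fun v hv => h.trans_le (faceMin_le x hv)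

theorem card_mul_faceMin_le (F : Finset V) (x : V → ℝ) :
    (F.card : ℝ) * faceMin F x ≤ ∑ v ∈ F, x v := by
  rw [← nsmul_eq_mul]
  exact Finset.card_nsmul_le_sum F x _ fun v hv => faceMin_le x hv

/-! ### Deforming the closed star to a point within the complex -/

/-- The mass of `x` that remains when, on each face `F` of `T`, every coordinate is lowered by the
least one. It is `0` at the barycentre of a face of `T`, and `1` outside the open faces of `T`. -/
noncomputable def outerMass (T : Finset (Finset V)) (x : V → ℝ) : ℝ :=
  1 - ∑ F ∈ T, (F.card : ℝ) * faceMin F x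

/-- The factor by which `coneDeform` multiplies the part of `x` that is counted in `outerMass`. -/
noncomputable def outerScale (T : Finset (Finset V)) (c : ℝ) (x : V → ℝ) : ℝ :=
  c * min 1 (2 - c * outerMass T x)

/-- A deformation with parameter `c`, from the identity for `c = 1` to a map that is constant on the
closed star for `c = 2`. In a face `F` of `T` let `s = outerMass T x`. The points with `s ≤ 1 / c`
are expanded from the barycentre, so that `s` becomes `c s` and the level `s = 1 / c` reaches the
boundary of `F`. Beyond this level, the boundary point reached is moved along the segment to `v₀`,
to which it gives up the mass `(c s - 1) ^ 2`. -/
noncomputable def coneDeform (T : Finset (Finset V)) (v₀ : V) (c : ℝ) (x : V → ℝ) (v : V) : ℝ :=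
  outerScale T c x * x v +
    ∑ F ∈ T, (max 0 ((F.card : ℝ)⁻¹ - c * ((F.card : ℝ)⁻¹ - faceMin F x)) -
      outerScale T c x * faceMin F x) * Set.indicator (F : Set V) 1 v +
    max (c * outerMass T x - 1) 0 ^ 2 * Set.indicator {v₀} 1 v

theorem continuous_coneDeform (hT : ∀ F ∈ T, F.Nonempty) (v₀ : V) :
    Continuous fun p : ℝ × (V → ℝ) => coneDeform T v₀ p.1 p.2 := by
  have hm : ∀ F ∈ T, Continuous fun p : ℝ × (V → ℝ) => faceMin F p.2 := fun F hF =>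
    (continuous_faceMin (hT F hF)).comp continuous_snd
  have hs : Continuous fun p : ℝ × (V → ℝ) => outerMass T p.2 :=
    continuous_const.sub (continuous_finsetSum _ fun F hF => continuous_const.mul (hm F hF))
  have ha : Continuous fun p : ℝ × (V → ℝ) => outerScale T p.1 p.2 := by
    unfold outerScale
    fun_prop
  refine continuous_pi fun v => ?_
  unfold coneDeform
  refine (Continuous.add (by fun_prop) (continuous_finsetSum _ fun F hF => ?_)).add (by fun_prop)
  have := hm F hF
  fun_prop

theorem faceMin_eq_zero_of_mem_closedStar {S : Set (Finset V)} (hS : IsShell X v₀ S)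
    {x : realization X} (hx : x ∈ closedStar X v₀) {F : Finset V} (hF : F ∈ S) :
    faceMin F (x : V → ℝ) = 0 :=
  (faceMin_eq_zero_or_pos x.2.1).resolve_right fun h => notMem_closedStar_of_pos hS hF h hx

theorem faceMin_eq_zero_of_ne {S : Set (Finset V)} (hS : IsShell X v₀ S) {x : realization X}
    {F G : Finset V} (hF : F ∈ S) (hxF : ∀ v, v ∉ F → (x : V → ℝ) v = 0) (hG : G ∈ S)
    (hne : G ≠ F) : faceMin G (x : V → ℝ) = 0 :=
  (faceMin_eq_zero_or_pos x.2.1).resolve_right fun h =>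
    hne (eq_of_pos_of_support hS hF hG h hxF)

theorem coeff_eq_zero_of_faceMin_eq_zero {F : Finset V} {x : V → ℝ} {c : ℝ} (hc : 1 ≤ c)
    (h : faceMin F x = 0) (a : ℝ) :
    max 0 ((F.card : ℝ)⁻¹ - c * ((F.card : ℝ)⁻¹ - faceMin F x)) - a * faceMin F x = 0 := by
  have hn : 0 ≤ (F.card : ℝ)⁻¹ := by positivity
  rw [h, max_eq_left (by nlinarith)]
  ring

theorem coneDeform_of_mem_closedStar (hS : IsShell X v₀ (T : Set (Finset V)))
    {x : realization X} (hx : x ∈ closedStar X v₀) {c : ℝ} (hc : 1 ≤ c) (v : V) :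
    coneDeform T v₀ c x v =
      c * (2 - c) * (x : V → ℝ) v + (c - 1) ^ 2 * Set.indicator {v₀} 1 v := by
  have hm := fun F hF => faceMin_eq_zero_of_mem_closedStar hS hx (F := F) hF
  have hs : outerMass T (x : V → ℝ) = 1 := by
    rw [outerMass, Finset.sum_eq_zero fun F hF => by rw [hm F hF, mul_zero], sub_zero]
  rw [coneDeform, Finset.sum_eq_zero fun F hF => by
    rw [coeff_eq_zero_of_faceMin_eq_zero hc (hm F hF), zero_mul], outerScale, hs,
    min_eq_right (by linarith), max_eq_left (by linarith)]
  ring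

theorem outerMass_of_support (hS : IsShell X v₀ (T : Set (Finset V)))
    {x : realization X} {F : Finset V} (hF : F ∈ T) (hxF : ∀ v, v ∉ F → (x : V → ℝ) v = 0) :
    outerMass T (x : V → ℝ) = 1 - F.card * faceMin F x := by
  rw [outerMass, Finset.sum_eq_single F]
  · intro G hG hne
    rw [faceMin_eq_zero_of_ne hS hF hxF hG hne, mul_zero]
  · exact fun h => absurd hF h

theorem coneDeform_of_support (hS : IsShell X v₀ (T : Set (Finset V)))
    {x : realization X} {F : Finset V} (hF : F ∈ T) (hxF : ∀ v, v ∉ F → (x : V → ℝ) v = 0)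
    {c : ℝ} (hc : 1 ≤ c) (v : V) :
    coneDeform T v₀ c x v = outerScale T c x * (x : V → ℝ) v +
      (max 0 (1 - c * outerMass T x) / F.card - outerScale T c x * faceMin F x) *
        Set.indicator (F : Set V) 1 v +
      max (c * outerMass T x - 1) 0 ^ 2 * Set.indicator {v₀} 1 v := by
  have hn : (0 : ℝ) < F.card := by exact_mod_cast (hS.nonempty hF).card_pos
  rw [coneDeform, Finset.sum_eq_single F]
  · congr 4
    rw [outerMass_of_support hS hF hxF, eq_div_iff hn.ne', max_mul_of_nonneg _ _ hn.le, zero_mul]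
    congr 1
    field_simp
  · intro G hG hne
    rw [coeff_eq_zero_of_faceMin_eq_zero hc (faceMin_eq_zero_of_ne hS hF hxF hG hne), zero_mul]
  · exact fun h => absurd hF h

theorem coneDeform_one (hS : IsShell X v₀ (T : Set (Finset V))) (x : realization X) :
    coneDeform T v₀ 1 x = x := by
  ext v
  rcases mem_closedStar_or_exists_interior hS x with hx | ⟨F, hF, -, hxF, hsum⟩
  · rw [coneDeform_of_mem_closedStar hS hx le_rfl]
    ring
  · have hn : (0 : ℝ) < F.card := by exact_mod_cast (hS.nonempty hF).card_pos
    have hm0 : 0 ≤ faceMin F (x : V → ℝ) := faceMin_nonneg x.2.1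
    have hm := mul_nonneg hn.le hm0
    rw [coneDeform_of_support hS hF hxF le_rfl, outerScale, outerMass_of_support hS hF hxF,
      min_eq_left (by linarith), max_eq_right (by linarith), max_eq_right (by linarith)]
    field_simp
    ring

theorem coneDeform_two_of_mem_closedStar (hS : IsShell X v₀ (T : Set (Finset V)))
    {x : realization X} (hx : x ∈ closedStar X v₀) :
    coneDeform T v₀ 2 x = Set.indicator {v₀} 1 := by
  ext v
  rw [coneDeform_of_mem_closedStar hS hx one_le_two]
  norm_num

/-- Moving a point of the closed simplex on `G` along the segment towards `v₀`, if `v₀ ∈ G`. -/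
theorem combination_mem_realization {G : Finset V} (hG : G ∈ X.faces) (hv : v₀ ∈ G) {y : V → ℝ}
    (hy : ∀ v, 0 ≤ y v) (hyG : ∀ v, v ∉ G → y v = 0) {K : Finset V} (hyK : ∀ v, v ∉ K → y v = 0)
    {γ : ℝ} (hγ : 0 ≤ γ) (hsum : ∑ v ∈ K, y v + γ = 1) :
    (fun v => y v + γ * Set.indicator {v₀} 1 v) ∈ realization X := by
  classical
  have hi : ∀ v, (0 : ℝ) ≤ Set.indicator {v₀} 1 v := fun v =>
    Set.indicator_nonneg (fun _ _ => zero_le_one) v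
  have hi0 : ∀ v, v ≠ v₀ → Set.indicator {v₀} (1 : V → ℝ) v = 0 := fun v h =>
    Set.indicator_of_notMem h 1
  refine mem_realization_of_sum_eq_one (K := K ∪ {v₀}) (fun v => add_nonneg (hy v)
    (mul_nonneg hγ (hi v))) hG (fun v h => ?_) (fun v h => ?_) ?_
  · rw [hyG v h, hi0 v fun h' => h (h' ▸ hv)]
    ring
  · simp only [Finset.mem_union, Finset.mem_singleton, not_or] at h
    rw [hyK v h.1, hi0 v h.2]
    ring
  · rw [Finset.sum_add_distrib, ← Finset.mul_sum,
      Finset.sum_eq_single_of_mem (s := K ∪ {v₀}) (f := Set.indicator {v₀} (1 : V → ℝ)) v₀ (by simp)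
        fun v _ h => hi0 v h,
      ← Finset.sum_subset (Finset.subset_union_left : K ⊆ K ∪ {v₀}) fun v _ h => hyK v h]
    simpa using hsum

theorem coneDeform_mem_of_mem_closedStar (hS : IsShell X v₀ (T : Set (Finset V)))
    {x : realization X} (hx : x ∈ closedStar X v₀) {c : ℝ} (hc : 1 ≤ c) (hc2 : c ≤ 2) :
    ∃ h : coneDeform T v₀ c x ∈ realization X, (⟨_, h⟩ : realization X) ∈ closedStar X v₀ := by
  obtain ⟨G, hG, hv, hxG⟩ := id hx
  have hform : coneDeform T v₀ c x = fun v => c * (2 - c) * (x : V → ℝ) v +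
      (c - 1) ^ 2 * Set.indicator {v₀} 1 v := by
    ext v
    exact coneDeform_of_mem_closedStar hS hx hc v
  have hcc : 0 ≤ c * (2 - c) := mul_nonneg (by linarith) (by linarith)
  refine ⟨?_, G, hG, hv, fun v hvG => ?_⟩
  · rw [hform]
    refine combination_mem_realization (K := G) hG hv (fun v => mul_nonneg hcc (x.2.1 v))
      (fun v h => by rw [hxG v h, mul_zero]) (fun v h => by rw [hxG v h, mul_zero])
      (sq_nonneg _) ?_
    rw [← Finset.mul_sum, sum_eq_one_of_support x.2 hxG]
    ring
  · have hne : v ∉ ({v₀} : Set V) := fun h => hvG ((Set.mem_singleton_iff.1 h) ▸ hv)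
    simp only [hform, hxG v hvG, Set.indicator_of_notMem hne, mul_zero, add_zero]

theorem coneDeform_mem_realization (hS : IsShell X v₀ (T : Set (Finset V)))
    (x : realization X) {c : ℝ} (hc : 1 ≤ c) (hc2 : c ≤ 2) :
    coneDeform T v₀ c x ∈ realization X := by
  classical
  rcases mem_closedStar_or_exists_interior hS x with hx | ⟨F, hF, -, hxF, hsum⟩
  · exact (coneDeform_mem_of_mem_closedStar hS hx hc hc2).1
  have hn : (0 : ℝ) < F.card := by exact_mod_cast (hS.nonempty hF).card_pos
  have hm0 : 0 ≤ faceMin F (x : V → ℝ) := faceMin_nonneg x.2.1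
  have hmn := mul_nonneg hn.le hm0
  have hms : outerMass T (x : V → ℝ) = 1 - F.card * faceMin F x := outerMass_of_support hS hF hxF
  have hs0 : 0 ≤ outerMass T (x : V → ℝ) := by
    have := card_mul_faceMin_le F (x : V → ℝ)
    linarith
  have hs1 : outerMass T (x : V → ℝ) ≤ 1 := by linarith
  have hform := coneDeform_of_support hS hF hxF hc
  set s := outerMass T (x : V → ℝ)
  set m := faceMin F (x : V → ℝ)
  have hsumF : ∑ v ∈ F, ((x : V → ℝ) v - m) = s := by
    rw [Finset.sum_sub_distrib, hsum, Finset.sum_const, nsmul_eq_mul, hms]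
  have hind : ∀ v ∈ F, Set.indicator (F : Set V) (1 : V → ℝ) v = 1 := fun v hv =>
    Set.indicator_of_mem (Finset.mem_coe.2 hv) 1
  have hind' : ∀ v, v ∉ F → Set.indicator (F : Set V) (1 : V → ℝ) v = 0 := fun v hv =>
    Set.indicator_of_notMem (fun h => hv (Finset.mem_coe.1 h)) 1
  rcases le_total (c * s) 1 with hcs | hcs
  · -- the inner part is expanded within the closed simplex on `F`
    have hform' : ∀ v, coneDeform T v₀ c x v =
        c * (x : V → ℝ) v + ((1 - c * s) / F.card - c * m) * Set.indicator (F : Set V) 1 v := by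
      intro v
      rw [hform v, outerScale, min_eq_left (by linarith), max_eq_right (by linarith),
        max_eq_right (by linarith)]
      ring
    have hF0 : ∀ v, v ∉ F → coneDeform T v₀ c x v = 0 := by
      intro v hv
      rw [hform' v, hxF v hv, hind' v hv]
      ring
    have hF1 : ∀ v ∈ F, coneDeform T v₀ c x v =
        c * ((x : V → ℝ) v - m) + (1 - c * s) / F.card := by
      intro v hv
      rw [hform' v, hind v hv]
      ring
    refine mem_realization_of_sum_eq_one (fun v => ?_) (hS.mem_faces hF) hF0 hF0 ?_
    · by_cases hv : v ∈ F
      · rw [hF1 v hv]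
        have := faceMin_le (x : V → ℝ) hv
        exact add_nonneg (mul_nonneg (by linarith) (by linarith))
          (div_nonneg (by linarith) hn.le)
      · rw [hF0 v hv]
    · rw [Finset.sum_congr rfl hF1, Finset.sum_add_distrib, ← Finset.mul_sum, hsumF,
        Finset.sum_const, nsmul_eq_mul]
      field_simp
      ring
  · -- the outer part ends up in the join of `v₀` with a proper subset of `F`
    obtain ⟨u, huF, hu⟩ := exists_eq_faceMin (hS.nonempty hF) (x : V → ℝ)
    obtain ⟨G, hG, hv₀, hGF⟩ := hS.isStarFace_of_ssubset F hF _ (Finset.erase_ssubset huF)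
    have ha : 0 ≤ c * (2 - c * s) := mul_nonneg (by linarith) (by nlinarith)
    let y : V → ℝ := fun v => c * (2 - c * s) *
      (((x : V → ℝ) v - m) * Set.indicator (F : Set V) 1 v)
    have hform' : coneDeform T v₀ c x =
        fun v => y v + (c * s - 1) ^ 2 * Set.indicator {v₀} 1 v := by
      ext v
      have hxi : (x : V → ℝ) v = (x : V → ℝ) v * Set.indicator (F : Set V) 1 v := by
        by_cases hv : v ∈ F
        · rw [hind v hv, mul_one]
        · rw [hxF v hv, zero_mul]
      rw [hform v, outerScale, min_eq_right (by linarith), max_eq_left (by linarith),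
        max_eq_left (by linarith)]
      simp only [y]
      linear_combination c * (2 - c * s) * hxi
    have hyF : ∀ v, v ∉ F → y v = 0 := fun v hv => by simp only [y, hind' v hv, mul_zero]
    rw [hform']
    refine combination_mem_realization (K := F) hG hv₀ (fun v => ?_) (fun v hv => ?_) hyF
      (sq_nonneg _) ?_
    · refine mul_nonneg ha ?_
      by_cases hv : v ∈ F
      · rw [hind v hv, mul_one]
        exact sub_nonneg.2 (faceMin_le _ hv)
      · rw [hind' v hv, mul_zero]
    · by_cases hvF : v ∈ F
      · have : v = u := by
          by_contra hne
          exact hv (hGF (Finset.mem_erase.2 ⟨hne, hvF⟩))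
        rw [this]
        change c * (2 - c * s) * (((x : V → ℝ) u - m) * _) = 0
        rw [hu, sub_self, zero_mul, mul_zero]
      · exact hyF v hvF
    · have : ∑ v ∈ F, y v = c * (2 - c * s) * s := by
        rw [Finset.sum_congr rfl fun v hv => show y v = c * (2 - c * s) * ((x : V → ℝ) v - m) by
          simp only [y, hind v hv, mul_one], ← Finset.mul_sum, hsumF]
      rw [this]
      ring

theorem exists_homotopyEquiv_collapse_closedStar (hS : IsShell X v₀ (T : Set (Finset V))) :
    ∃ e : ContinuousMap.HomotopyEquiv (realization X) (Collapse (closedStar X v₀)),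
      ∀ x, e x = collapseMap (closedStar X v₀) x := by
  have hc : ∀ t : unitInterval, 1 ≤ 1 + (t : ℝ) ∧ 1 + (t : ℝ) ≤ 2 := fun t =>
    ⟨by linarith [t.2.1], by linarith [t.2.2]⟩
  refine exists_homotopyEquiv_collapse _
    (fun p => ⟨coneDeform T v₀ (1 + (p.1 : ℝ)) p.2,
      coneDeform_mem_realization hS p.2 (hc p.1).1 (hc p.1).2⟩) ?_ ?_ ?_ ?_
  · exact Continuous.subtype_mk ((continuous_coneDeform (fun F hF => hS.nonempty hF) v₀).comp
      (by fun_prop : Continuous fun p : unitInterval × realization X =>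
        (1 + (p.1 : ℝ), (p.2 : V → ℝ)))) _
  · intro x
    refine Subtype.ext ?_
    simpa using coneDeform_one hS x
  · intro t x hx
    exact (coneDeform_mem_of_mem_closedStar hS hx (hc t).1 (hc t).2).2
  · intro x hx y hy
    have h2 : (1 : ℝ) + ((1 : unitInterval) : ℝ) = 2 := by norm_num
    refine Subtype.ext ?_
    simp only [h2]
    rw [coneDeform_two_of_mem_closedStar hS hx, coneDeform_two_of_mem_closedStar hS hy]

end Quota

/-! ### Collapsing the boundary of a simplex -/

namespace Quota

/-- The denominator in `simplexToSphere`, without the square of the least coordinate. -/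
noncomputable def spread {n : ℕ} (x : Fin (n + 1) → ℝ) : ℝ :=
  ∑ i : Fin n, (x i.succ - x 0) ^ 2 + (1 - ∑ i, x i) ^ 2

/-- The map from the standard simplex to the sphere that collapses the boundary to the base point.
With `r` the least coordinate of `x`, the interior of the simplex is identified with `ℝ ^ n` by
`x ↦ ((x i - x 0) / r)`, and `ℝ ^ n` with the complement of the base point by inverse stereographic
projection; the formula below clears denominators, so that it also makes sense for `r = 0`.
The last summand of `spread` vanishes on the simplex, and keeps the formula continuous on the whole
space. -/
noncomputable def simplexToSphere {n : ℕ} (x : Fin (n + 1) → ℝ) : EuclideanSpace ℝ (Fin (n + 1)) :=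
  WithLp.toLp 2 (Fin.cons ((spread x - (⨅ i, x i) ^ 2) / (spread x + (⨅ i, x i) ^ 2))
    fun i : Fin n => 2 * (⨅ i, x i) * (x i.succ - x 0) / (spread x + (⨅ i, x i) ^ 2))

section Simplex

variable {n : ℕ}

theorem simplexToSphere_zero (x : Fin (n + 1) → ℝ) : simplexToSphere x 0 =
    (spread x - (⨅ i, x i) ^ 2) / (spread x + (⨅ i, x i) ^ 2) := rfl

theorem simplexToSphere_succ (x : Fin (n + 1) → ℝ) (i : Fin n) : simplexToSphere x i.succ =
    2 * (⨅ i, x i) * (x i.succ - x 0) / (spread x + (⨅ i, x i) ^ 2) := rfl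

theorem spread_nonneg (x : Fin (n + 1) → ℝ) : 0 ≤ spread x :=
  add_nonneg (Finset.sum_nonneg fun _ _ => sq_nonneg _) (sq_nonneg _)

theorem spread_add_sq_pos (x : Fin (n + 1) → ℝ) : 0 < spread x + (⨅ i, x i) ^ 2 := by
  refine lt_of_le_of_ne (add_nonneg (spread_nonneg x) (sq_nonneg _)) fun h => ?_
  have h1 := sq_nonneg (⨅ i, x i)
  have h2 : 0 ≤ ∑ i : Fin n, (x i.succ - x 0) ^ 2 := Finset.sum_nonneg fun _ _ => sq_nonneg _
  have h3 := sq_nonneg (1 - ∑ i, x i)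
  have hs : spread x = ∑ i : Fin n, (x i.succ - x 0) ^ 2 + (1 - ∑ i, x i) ^ 2 := rfl
  have hr : (⨅ i, x i) = 0 := by
    rw [← sq_eq_zero_iff]
    linarith
  have hsum : 1 - ∑ i, x i = 0 := by
    rw [← sq_eq_zero_iff]
    linarith
  have hd : ∑ i : Fin n, (x i.succ - x 0) ^ 2 = 0 := by linarith
  rw [Finset.sum_eq_zero_iff_of_nonneg fun _ _ => sq_nonneg _] at hd
  have hx : ∀ i, x i = x 0 := by
    intro i
    refine Fin.cases rfl (fun j => ?_) i
    exact sub_eq_zero.1 (sq_eq_zero_iff.1 (hd j (Finset.mem_univ j)))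
  obtain ⟨i, hi⟩ := exists_eq_ciInf_of_finite (f := x)
  have hx0 : ∀ j, x j = 0 := fun j => by rw [hx j, ← hx i, hi, hr]
  simp [hx0] at hsum

theorem continuous_simplexToSphere :
    Continuous (simplexToSphere : (Fin (n + 1) → ℝ) → EuclideanSpace ℝ (Fin (n + 1))) := by
  have hr : Continuous fun x : Fin (n + 1) → ℝ => ⨅ i, x i := continuous_iInf_of_finite
  have hs : Continuous (spread : (Fin (n + 1) → ℝ) → ℝ) := by
    unfold spread
    fun_prop
  refine (PiLp.continuous_toLp 2 _).comp (continuous_pi fun i => ?_)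
  refine Fin.cases ?_ (fun j => ?_) i
  · exact Continuous.div (by fun_prop) (by fun_prop) fun x => (spread_add_sq_pos x).ne'
  · exact Continuous.div (by fun_prop) (by fun_prop) fun x => (spread_add_sq_pos x).ne'

theorem norm_sq_eq_zero_add_succ (p : EuclideanSpace ℝ (Fin (n + 1))) :
    ‖p‖ ^ 2 = p 0 ^ 2 + ∑ i : Fin n, p i.succ ^ 2 := by
  rw [EuclideanSpace.real_norm_sq_eq, Fin.sum_univ_succ]

theorem spread_eq_of_sum_eq_one {x : Fin (n + 1) → ℝ} (h : ∑ i, x i = 1) :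
    spread x = ∑ i : Fin n, (x i.succ - x 0) ^ 2 := by
  rw [spread, h]
  ring

theorem norm_simplexToSphere {x : Fin (n + 1) → ℝ} (h : (⨅ i, x i) = 0 ∨ ∑ i, x i = 1) :
    ‖simplexToSphere x‖ = 1 := by
  have hD := spread_add_sq_pos x
  rw [← sq_eq_sq₀ (norm_nonneg _) zero_le_one, norm_sq_eq_zero_add_succ]
  simp only [simplexToSphere_zero, simplexToSphere_succ, div_pow, mul_pow]
  rw [← Finset.sum_div, ← Finset.mul_sum]
  rcases h with h | h
  · rw [h] at hD ⊢
    field_simp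
    ring
  · rw [← spread_eq_of_sum_eq_one h]
    field_simp
    ring

theorem sphereBase_coe_zero : (sphereBase n : EuclideanSpace ℝ (Fin (n + 1))) 0 = 1 := by
  simp [sphereBase]

theorem sphereBase_coe_succ (i : Fin n) :
    (sphereBase n : EuclideanSpace ℝ (Fin (n + 1))) i.succ = 0 := by
  simp [sphereBase, Fin.succ_ne_zero]

theorem simplexToSphere_eq_base_iff {x : Fin (n + 1) → ℝ} :
    simplexToSphere x = sphereBase n ↔ (⨅ i, x i) = 0 := by
  have hD := spread_add_sq_pos x
  constructor
  · intro h
    have h0 := congrArg (fun p : EuclideanSpace ℝ (Fin (n + 1)) => p 0) h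
    simp only [simplexToSphere_zero, sphereBase_coe_zero] at h0
    rw [div_eq_one_iff_eq hD.ne'] at h0
    rw [← sq_eq_zero_iff]
    linarith
  · intro h
    ext i
    refine Fin.cases ?_ (fun j => ?_) i
    · rw [simplexToSphere_zero, sphereBase_coe_zero, div_eq_one_iff_eq hD.ne', h]
      ring
    · rw [simplexToSphere_succ, sphereBase_coe_succ, h]
      ring

theorem simplexToSphere_injective_of_pos {x x' : Fin (n + 1) → ℝ} (hr : 0 < ⨅ i, x i)
    (hr' : 0 < ⨅ i, x' i) (hx : ∑ i, x i = 1) (hx' : ∑ i, x' i = 1)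
    (h : simplexToSphere x = simplexToSphere x') : x = x' := by
  have hD := spread_add_sq_pos x
  have hD' := spread_add_sq_pos x'
  have h0 := congrArg (fun p : EuclideanSpace ℝ (Fin (n + 1)) => p 0) h
  simp only [simplexToSphere_zero] at h0
  have hle : ∀ i, (⨅ i, x i) ≤ x i := fun i => ciInf_le (Set.finite_range x).bddBelow i
  have hle' : ∀ i, (⨅ i, x' i) ≤ x' i := fun i => ciInf_le (Set.finite_range x').bddBelow i
  obtain ⟨j, hj⟩ := exists_eq_ciInf_of_finite (f := x)
  obtain ⟨j', hj'⟩ := exists_eq_ciInf_of_finite (f := x')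
  have hS : ∀ i : Fin n, simplexToSphere x i.succ = simplexToSphere x' i.succ := fun i => by rw [h]
  simp only [simplexToSphere_succ] at hS
  set r := ⨅ i, x i
  set r' := ⨅ i, x' i
  set D := spread x + r ^ 2 with hDdef
  set D' := spread x' + r' ^ 2 with hDdef'
  rw [div_eq_div_iff hD.ne' hD'.ne', show spread x = D - r ^ 2 by rw [hDdef]; ring,
    show spread x' = D' - r' ^ 2 by rw [hDdef']; ring] at h0
  have hrr : r' ^ 2 * D = r ^ 2 * D' := by linarith
  -- the affine coordinates `(x i - x 0) / r` agree
  have hcoord : ∀ i, r' * (x i - x 0) = r * (x' i - x' 0) := by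
    intro i
    refine Fin.cases (by ring) (fun k => ?_) i
    have hk := hS k
    rw [div_eq_div_iff hD.ne' hD'.ne'] at hk
    have hne : 2 * r * r' * D ≠ 0 := by positivity
    refine mul_left_cancel₀ hne ?_
    linear_combination 2 * r * (x k.succ - x 0) * hrr + r ^ 2 * hk
  -- so that the vectors `x / r` and `x' / r'`, both with least coordinate `1`, are equal
  have h1 : r' * x 0 = r * x' 0 := by
    have e1 := hcoord j
    have e2 := hcoord j'
    rw [hj] at e1
    rw [hj'] at e2
    have := mul_le_mul_of_nonneg_left (hle' j) hr.le
    have := mul_le_mul_of_nonneg_left (hle j') hr'.le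
    nlinarith
  have h2 : ∀ i, r' * x i = r * x' i := fun i => by linarith [hcoord i]
  have h3 : r' = r := by
    have : ∑ i, r' * x i = ∑ i, r * x' i := Finset.sum_congr rfl fun i _ => h2 i
    rwa [← Finset.mul_sum, ← Finset.mul_sum, hx, hx', mul_one, mul_one] at this
  ext i
  have := h2 i
  rw [h3] at this
  exact mul_left_cancel₀ hr.ne' this

theorem exists_simplexToSphere_eq (p : Sphere n) (hp : p ≠ sphereBase n) :
    ∃ x : Fin (n + 1) → ℝ, (∀ i, 0 < x i) ∧ ∑ i, x i = 1 ∧ simplexToSphere x = p := by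
  obtain ⟨p, hpn⟩ := p
  have hnorm : p 0 ^ 2 + ∑ i : Fin n, p i.succ ^ 2 = 1 := by
    rw [← norm_sq_eq_zero_add_succ, mem_sphere_zero_iff_norm.1 hpn, one_pow]
  have hnn : 0 ≤ ∑ i : Fin n, p i.succ ^ 2 := Finset.sum_nonneg fun _ _ => sq_nonneg _
  have hp0 : 0 < 1 - p 0 := by
    have hle : p 0 ≤ 1 := by nlinarith
    refine sub_pos.2 (lt_of_le_of_ne hle fun h => hp (Subtype.ext ?_))
    have hz : ∑ i : Fin n, p i.succ ^ 2 = 0 := by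
      rw [h] at hnorm
      linarith
    rw [Finset.sum_eq_zero_iff_of_nonneg fun _ _ => sq_nonneg _] at hz
    ext i
    refine Fin.cases ?_ (fun j => ?_) i
    · exact h.trans sphereBase_coe_zero.symm
    · rw [sphereBase_coe_succ]
      exact sq_eq_zero_iff.1 (hz j (Finset.mem_univ j))
  -- `z` is the stereographic projection of `p`, and `x` is the multiple with sum `1` of the
  -- translate of `z` with least coordinate `1`
  let z : Fin (n + 1) → ℝ := Fin.cons 0 fun i => p i.succ / (1 - p 0)
  have hz0 : z 0 = 0 := rfl
  have hzs : ∀ i : Fin n, z i.succ = p i.succ / (1 - p 0) := fun i => rfl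
  obtain ⟨j, hj⟩ := exists_eq_ciInf_of_finite (f := z)
  have hle : ∀ i, z j ≤ z i := fun i => hj ▸ ciInf_le (Set.finite_range z).bddBelow i
  have hpos : 0 < ∑ i, (z i + 1 - z j) :=
    Finset.sum_pos (fun i _ => by linarith [hle i]) Finset.univ_nonempty
  set m := (∑ i, (z i + 1 - z j))⁻¹ with hm
  have hm0 : 0 < m := inv_pos.2 hpos
  let x : Fin (n + 1) → ℝ := fun i => m * (z i + 1 - z j)
  have hxle : ∀ i, m ≤ x i := fun i => le_mul_of_one_le_right hm0.le (by linarith [hle i])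
  have hinf : (⨅ i, x i) = m := by
    refine le_antisymm ((ciInf_le (Set.finite_range x).bddBelow j).trans_eq ?_) (le_ciInf hxle)
    change m * (z j + 1 - z j) = m
    ring
  have hsum : ∑ i, x i = 1 := by
    rw [← Finset.mul_sum, hm, inv_mul_cancel₀ hpos.ne']
  have hdiff : ∀ i : Fin n, x i.succ - x 0 = m * (p i.succ / (1 - p 0)) := by
    intro i
    change m * (z i.succ + 1 - z j) - m * (z 0 + 1 - z j) = _
    rw [hz0, hzs]
    ring
  have hspread : spread x = m ^ 2 * ((1 + p 0) / (1 - p 0)) := by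
    rw [spread_eq_of_sum_eq_one hsum]
    simp only [hdiff, mul_pow, div_pow]
    rw [← Finset.mul_sum, ← Finset.sum_div,
      show ∑ i : Fin n, p i.succ ^ 2 = (1 - p 0) * (1 + p 0) by linarith]
    field_simp
  have hD : spread x + (⨅ i, x i) ^ 2 = m ^ 2 * (2 / (1 - p 0)) := by
    rw [hspread, hinf]
    field_simp
    ring
  refine ⟨x, fun i => hm0.trans_le (hxle i), hsum, ?_⟩
  ext i
  refine Fin.cases ?_ (fun k => ?_) i
  · rw [simplexToSphere_zero, hD, hspread, hinf]
    field_simp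
    ring
  · rw [simplexToSphere_succ, hD, hinf, hdiff]
    field_simp

end Simplex

/-! ### The quotient by the closed star as a bouquet of spheres -/

theorem exists_homeomorph_of_range_eq {K K' T : Type*} [TopologicalSpace K] [TopologicalSpace K']
    [TopologicalSpace T] [CompactSpace K] [CompactSpace K'] [T2Space T] {f : K → T} {g : K' → T}
    (hf : Continuous f) (hg : Continuous g) (hfi : Function.Injective f)
    (hgi : Function.Injective g) (h : Set.range f = Set.range g) :
    ∃ e : K ≃ₜ K', ∀ x, g (e x) = f x := by
  have hf' := (hf.isClosedEmbedding hfi).isEmbedding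
  have hg' := (hg.isClosedEmbedding hgi).isEmbedding
  refine ⟨hf'.toHomeomorph.trans ((Homeomorph.setCongr h).trans hg'.toHomeomorph.symm),
    fun x => ?_⟩
  exact congrArg Subtype.val (hg'.toHomeomorph.apply_symm_apply (Homeomorph.setCongr h _))

section Bouquet

variable {J : Type*} (d : J → ℕ)

open Classical in
/-- The map from the disjoint union of a point and the spheres to the product of the spheres, onto
the points with at most one coordinate different from the base point. -/
noncomputable def sumToPi : Unit ⊕ (Σ j : J, Sphere (d j)) → ∀ j, Sphere (d j)
  | Sum.inl _ => fun j => sphereBase (d j)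
  | Sum.inr s => Function.update (fun j => sphereBase (d j)) s.1 s.2

open Classical in
theorem continuous_sumToPi : Continuous (sumToPi d) := by
  refine continuous_sum_dom.2 ⟨continuous_const, continuous_sigma fun j => ?_⟩
  exact continuous_const.update j continuous_id

open Classical in
theorem sumToPi_of_mem_basePoints {a : Unit ⊕ (Σ j : J, Sphere (d j))} (ha : a ∈ basePoints d) :
    sumToPi d a = fun j => sphereBase (d j) := by
  rcases ha with rfl | ⟨j, rfl⟩
  · rfl
  · exact Function.update_eq_self _ _

theorem sumToPi_inr_apply_self (j : J) (s : Sphere (d j)) : sumToPi d (Sum.inr ⟨j, s⟩) j = s := by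
  simp only [sumToPi, Function.update_self]

open Classical in
theorem sumToPi_inr_apply_of_ne {i j : J} (h : i ≠ j) (s : Sphere (d j)) :
    sumToPi d (Sum.inr ⟨j, s⟩) i = sphereBase (d i) := by
  simp only [sumToPi, Function.update_of_ne h]

theorem sumToPi_eq_iff {a b : Unit ⊕ (Σ j : J, Sphere (d j))} :
    sumToPi d a = sumToPi d b ↔ a = b ∨ (a ∈ basePoints d ∧ b ∈ basePoints d) := by
  constructor
  · intro h
    by_cases ha : a ∈ basePoints d
    · by_cases hb : b ∈ basePoints d
      · exact Or.inr ⟨ha, hb⟩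
      · rw [sumToPi_of_mem_basePoints d ha] at h
        rcases b with b | ⟨j, s⟩
        · exact absurd (Or.inl rfl) hb
        · have := congrFun h j
          rw [sumToPi_inr_apply_self] at this
          exact absurd (Or.inr ⟨j, by rw [this]⟩) hb
    · rcases a with a | ⟨j, s⟩
      · exact absurd (Or.inl rfl) ha
      · have hs : s ≠ sphereBase (d j) := fun hs => ha (Or.inr ⟨j, by rw [hs]⟩)
        have hj := congrFun h j
        rw [sumToPi_inr_apply_self] at hj
        rcases b with b | ⟨i, t⟩
        · exact absurd hj hs
        · by_cases hij : j = i
          · subst hij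
            rw [sumToPi_inr_apply_self] at hj
            rw [hj]
            exact Or.inl rfl
          · rw [sumToPi_inr_apply_of_ne d hij] at hj
            exact absurd hj hs
  · rintro (rfl | ⟨ha, hb⟩)
    · rfl
    · rw [sumToPi_of_mem_basePoints d ha, sumToPi_of_mem_basePoints d hb]

end Bouquet

/-- A space `Y / A` is homeomorphic to the bouquet if `Y` has a map to the product of the spheres
with the same image as the bouquet, and whose only nontrivial fibre is `A`. -/
theorem exists_homeomorph_bouquet {Y J : Type*} [TopologicalSpace Y] [CompactSpace Y] [Finite J]
    (d : J → ℕ) (A : Set Y) (f : Y → ∀ j, Sphere (d j)) (hf : Continuous f)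
    (hfA : ∀ x y, f x = f y ↔ x = y ∨ (x ∈ A ∧ y ∈ A))
    (hbase : ∀ x ∈ A, f x = fun j => sphereBase (d j))
    (hrange : Set.range f = Set.range (sumToPi d)) :
    ∃ h : Collapse A ≃ₜ Bouquet d, ∀ x ∈ A, h (collapseMap A x) = Bouquet.base d := by
  let f' : Collapse A → ∀ j, Sphere (d j) := Quotient.lift f fun x y h => (hfA x y).2 h
  let g' : Bouquet d → ∀ j, Sphere (d j) :=
    Quotient.lift (sumToPi d) fun x y h => (sumToPi_eq_iff d).2 h
  have hf' : Function.Injective f' := by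
    rintro ⟨x⟩ ⟨y⟩ h
    exact Quotient.sound ((hfA x y).1 h)
  have hg' : Function.Injective g' := by
    rintro ⟨x⟩ ⟨y⟩ h
    exact Quotient.sound ((sumToPi_eq_iff d).1 h)
  have hr : Set.range f' = Set.range g' := by
    exact (Set.range_quotient_lift (s := collapseSetoid A) _).trans
      (hrange.trans (Set.range_quotient_lift (s := collapseSetoid (basePoints d)) _).symm)
  obtain ⟨e, he⟩ := exists_homeomorph_of_range_eq (hf.quotient_lift _)
    ((continuous_sumToPi d).quotient_lift _) hf' hg' hr
  refine ⟨e, fun x hx => hg' ?_⟩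
  exact (he (collapseMap A x)).trans (hbase x hx)

section Realization

variable {V : Type*} {X : PreAbstractSimplicialComplex V} {v₀ : V} {S : Set (Finset V)}

/-- A numbering of the vertices of `F`. -/
noncomputable def faceEquiv {F : Finset V} (hF : F.Nonempty) : Fin (F.card - 1 + 1) ≃ F :=
  (finCongr (Nat.sub_add_cancel hF.card_pos)).trans F.equivFin.symm

theorem sum_faceEquiv {F : Finset V} (hF : F.Nonempty) (x : V → ℝ) :
    ∑ i, x (faceEquiv hF i) = ∑ v ∈ F, x v := by
  rw [Equiv.sum_comp (faceEquiv hF) fun v : F => x v, Finset.sum_coe_sort]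

theorem iInf_faceEquiv {F : Finset V} (hF : F.Nonempty) (x : V → ℝ) :
    ⨅ i, x (faceEquiv hF i) = faceMin F x :=
  (faceEquiv hF).iInf_comp (g := fun v : F => x v)

/-- The map `|X| → S ^ dim F` that collapses the complement of the open face `F`. -/
noncomputable def faceToSphere (hS : IsShell X v₀ S) (x : realization X) (F : S) :
    Sphere ((F : Finset V).card - 1) :=
  ⟨simplexToSphere fun i => (x : V → ℝ) (faceEquiv (hS.nonempty F.2) i), by
    rw [mem_sphere_zero_iff_norm]
    refine norm_simplexToSphere ?_
    rw [iInf_faceEquiv, sum_faceEquiv]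
    exact (faceMin_eq_zero_or_pos x.2.1).imp_right fun h =>
      sum_eq_one_of_support x.2 (support_subset_of_pos hS F.2 h)⟩

theorem continuous_faceToSphere (hS : IsShell X v₀ S) : Continuous (faceToSphere hS) :=
  continuous_pi fun _ => Continuous.subtype_mk (continuous_simplexToSphere.comp
    (continuous_pi fun _ => (continuous_apply _).comp continuous_subtype_val)) _

theorem faceToSphere_eq_base_iff (hS : IsShell X v₀ S) (x : realization X) (F : S) :
    faceToSphere hS x F = sphereBase _ ↔ faceMin (F : Finset V) (x : V → ℝ) = 0 := by
  rw [← iInf_faceEquiv (hS.nonempty F.2), ← simplexToSphere_eq_base_iff, Subtype.ext_iff]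
  rfl

theorem faceMin_pos {F : Finset V} (hF : F.Nonempty) {x : V → ℝ} (h : ∀ v ∈ F, 0 < x v) :
    0 < faceMin F x := by
  obtain ⟨v, hv, hvx⟩ := exists_eq_faceMin hF x
  exact hvx ▸ h v hv

theorem faceToSphere_of_mem_closedStar (hS : IsShell X v₀ S) {x : realization X}
    (hx : x ∈ closedStar X v₀) : faceToSphere hS x = fun _ => sphereBase _ := by
  funext F
  rw [faceToSphere_eq_base_iff]
  exact faceMin_eq_zero_of_mem_closedStar hS hx F.2

/-- An interior point of the face `F` is sent to a point of the sphere of `F` in the product. -/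
theorem faceToSphere_of_pos (hS : IsShell X v₀ S) {x : realization X} {F : S}
    (hpos : ∀ v ∈ (F : Finset V), 0 < (x : V → ℝ) v) :
    faceToSphere hS x = sumToPi (fun F : S => (F : Finset V).card - 1)
      (Sum.inr ⟨F, faceToSphere hS x F⟩) := by
  funext G
  by_cases hGF : G = F
  · subst hGF
    rw [sumToPi_inr_apply_self]
  · rw [sumToPi_inr_apply_of_ne _ hGF, faceToSphere_eq_base_iff]
    exact faceMin_eq_zero_of_ne hS F.2 (support_subset_of_pos hS F.2 hpos) G.2
      fun h => hGF (Subtype.ext h)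

theorem eq_of_faceToSphere_eq (hS : IsShell X v₀ S) {x y : realization X}
    (hx : x ∉ closedStar X v₀) (h : faceToSphere hS x = faceToSphere hS y) : x = y := by
  obtain ⟨F, hF, hpos, hxF, hsum⟩ := (mem_closedStar_or_exists_interior hS x).resolve_left hx
  have hm := faceMin_pos (hS.nonempty hF) hpos
  have hFeq := congrFun h ⟨F, hF⟩
  have hym : faceMin F (y : V → ℝ) ≠ 0 := by
    intro h0
    rw [(faceToSphere_eq_base_iff hS y ⟨F, hF⟩).2 h0, faceToSphere_eq_base_iff] at hFeq
    exact hm.ne' hFeq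
  have hypos := (faceMin_eq_zero_or_pos y.2.1).resolve_left hym
  have hyF := support_subset_of_pos hS hF hypos
  have heq := simplexToSphere_injective_of_pos (by rwa [iInf_faceEquiv])
    (by rw [iInf_faceEquiv]; exact faceMin_pos (hS.nonempty hF) hypos)
    (by rwa [sum_faceEquiv]) (by rw [sum_faceEquiv]; exact sum_eq_one_of_support y.2 hyF)
    (congrArg Subtype.val hFeq)
  ext v
  by_cases hv : v ∈ F
  · have := congrFun heq ((faceEquiv (hS.nonempty hF)).symm ⟨v, hv⟩)
    simpa using this
  · rw [hxF v hv, hyF v hv]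

theorem exists_faceToSphere_eq (hS : IsShell X v₀ S) (F : S)
    (p : Sphere ((F : Finset V).card - 1)) (hp : p ≠ sphereBase _) :
    ∃ x : realization X, faceToSphere hS x =
      sumToPi (fun F : S => (F : Finset V).card - 1) (Sum.inr ⟨F, p⟩) := by
  classical
  obtain ⟨y, hy, hsum, hyp⟩ := exists_simplexToSphere_eq p hp
  have hne := hS.nonempty F.2
  let x : V → ℝ := fun v => if h : v ∈ (F : Finset V) then y ((faceEquiv hne).symm ⟨v, h⟩) else 0
  have hxy : ∀ i, x (faceEquiv hne i) = y i := by
    intro i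
    simp only [x, Finset.coe_mem, dif_pos, Subtype.coe_eta, Equiv.symm_apply_apply]
  have hpos : ∀ v ∈ (F : Finset V), 0 < x v := by
    intro v hv
    simp only [x, dif_pos hv]
    exact hy _
  have hx0 : ∀ v, v ∉ (F : Finset V) → x v = 0 := fun v hv => dif_neg hv
  have hx : x ∈ realization X := by
    refine ⟨fun v => ?_, F, hS.mem_faces F.2, hx0, ?_⟩
    · by_cases hv : v ∈ (F : Finset V)
      · exact (hpos v hv).le
      · exact (hx0 v hv).ge
    · rw [← sum_faceEquiv hne, ← hsum]
      exact Finset.sum_congr rfl fun i _ => hxy i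
  refine ⟨⟨x, hx⟩, ?_⟩
  have hval : faceToSphere hS ⟨x, hx⟩ F = p := by
    refine Subtype.ext ?_
    rw [← hyp, ← funext hxy]
    rfl
  rw [faceToSphere_of_pos hS (x := ⟨x, hx⟩) hpos, hval]

theorem exists_homeomorph_collapse_closedStar (hS : IsShell X v₀ S) (hfin : X.faces.Finite)
    (hv : {v₀} ∈ X.faces) :
    ∃ h : Collapse (closedStar X v₀) ≃ₜ Bouquet (fun F : S => (F : Finset V).card - 1),
      ∀ x ∈ closedStar X v₀, h (collapseMap _ x) = Bouquet.base _ := by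
  have : CompactSpace (realization X) := isCompact_iff_compactSpace.1 (isCompact_realization hfin)
  have : Finite S := (hfin.subset fun F hF => hS.mem_faces hF).to_subtype
  refine exists_homeomorph_bouquet _ _ (faceToSphere hS) (continuous_faceToSphere hS)
    (fun x y => ?_) (fun x hx => faceToSphere_of_mem_closedStar hS hx) ?_
  · constructor
    · intro h
      by_cases hx : x ∈ closedStar X v₀
      · by_cases hy : y ∈ closedStar X v₀
        · exact Or.inr ⟨hx, hy⟩
        · exact Or.inl (eq_of_faceToSphere_eq hS hy h.symm).symm
      · exact Or.inl (eq_of_faceToSphere_eq hS hx h)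
    · rintro (rfl | ⟨hx, hy⟩)
      · rfl
      · rw [faceToSphere_of_mem_closedStar hS hx, faceToSphere_of_mem_closedStar hS hy]
  · obtain ⟨a, ha⟩ := exists_mem_closedStar hv
    have hbase := faceToSphere_of_mem_closedStar hS ha
    refine Set.Subset.antisymm ?_ ?_
    · rintro _ ⟨x, rfl⟩
      rcases mem_closedStar_or_exists_interior hS x with hx | ⟨F, hF, hpos, -, -⟩
      · exact ⟨Sum.inl (), (faceToSphere_of_mem_closedStar hS hx).symm⟩
      · exact ⟨_, (faceToSphere_of_pos hS (F := ⟨F, hF⟩) hpos).symm⟩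
    · rintro _ ⟨b, rfl⟩
      by_cases hb : b ∈ basePoints (fun F : S => (F : Finset V).card - 1)
      · exact ⟨a, hbase.trans (sumToPi_of_mem_basePoints _ hb).symm⟩
      · rcases b with b | ⟨F, p⟩
        · exact absurd (Or.inl rfl) hb
        · exact exists_faceToSphere_eq hS F p fun hp => hb (Or.inr ⟨F, by rw [hp]⟩)

end Realization

end Quota

/-! ### Reduced homology -/

namespace Quota

variable {V : Type*} [LinearOrder V] {X : PreAbstractSimplicialComplex V} {v₀ : V}
  {S : Set (Finset V)}

/-- The sign with which `v` enters the oriented simplex on `F ∪ {v}`. -/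
def faceSign (F : Finset V) (v : V) : ℤ := (-1) ^ (F.filter (· < v)).card

/-- The cone operator with apex `v₀`: a simplex is sent to its join with `v₀`, up to sign, if it
does not contain `v₀`, and to `0` otherwise. -/
noncomputable def coneOperator (v₀ : V) : (Finset V →₀ ℤ) →ₗ[ℤ] (Finset V →₀ ℤ) :=
  Finsupp.linearCombination ℤ fun F : Finset V =>
    if v₀ ∈ F then 0 else Finsupp.single (insert v₀ F) (faceSign F v₀)

theorem coneOperator_single_of_mem {F : Finset V} (h : v₀ ∈ F) (a : ℤ) :
    coneOperator v₀ (Finsupp.single F a) = 0 := by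
  simp [coneOperator, Finsupp.linearCombination_single, h]

theorem coneOperator_single_of_notMem {F : Finset V} (h : v₀ ∉ F) (a : ℤ) :
    coneOperator v₀ (Finsupp.single F a) =
      Finsupp.single (insert v₀ F) (a * faceSign F v₀) := by
  simp [coneOperator, Finsupp.linearCombination_single, h]

theorem boundary_single_eq_sum (F : Finset V) (a : ℤ) :
    boundary V (Finsupp.single F a) =
      ∑ v ∈ F, Finsupp.single (F.erase v) (a * faceSign F v) := by
  rw [boundary_single, Finset.smul_sum]
  simp [faceSign]

theorem faceSign_mul_self (F : Finset V) (v : V) : faceSign F v * faceSign F v = 1 := by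
  rw [faceSign, ← mul_pow]
  simp

theorem faceSign_insert_self (F : Finset V) (v : V) : faceSign (insert v F) v = faceSign F v := by
  rw [faceSign, faceSign, Finset.filter_insert, if_neg (lt_irrefl v)]

theorem faceSign_erase_self (F : Finset V) (v : V) : faceSign (F.erase v) v = faceSign F v := by
  rw [faceSign, faceSign, Finset.filter_erase, Finset.erase_eq_of_notMem (by simp)]

/-- Adding `u` and removing `v` in the two possible orders gives opposite signs. -/
theorem faceSign_mul_faceSign_insert {F : Finset V} {u v : V} (hu : u ∉ F) (hv : v ∈ F) :
    faceSign F u * faceSign (insert u F) v = -(faceSign F v * faceSign (F.erase v) u) := by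
  have hne : u ≠ v := fun h => hu (h ▸ hv)
  simp only [faceSign, Finset.filter_insert, Finset.filter_erase]
  rcases lt_or_gt_of_ne hne with h | h
  · rw [if_pos h, Finset.card_insert_of_notMem (by simp [hu]),
      Finset.erase_eq_of_notMem (by simp [h.le])]
    ring
  · rw [if_neg h.not_gt, ← Finset.card_erase_add_one (by simp [hv, h] : v ∈ F.filter (· < u))]
    ring

/-- The cone operator is a contracting homotopy of the augmented chains on all finite sets. -/
theorem boundary_coneOperator_add (v₀ : V) (c : Finset V →₀ ℤ) :
    boundary V (coneOperator v₀ c) + coneOperator v₀ (boundary V c) = c := by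
  induction c using Finsupp.induction_linear with
  | zero => simp
  | add f g hf hg =>
    rw [map_add, map_add, map_add, map_add, add_add_add_comm, hf, hg]
  | single F a =>
    rw [boundary_single_eq_sum, map_sum]
    by_cases h : v₀ ∈ F
    · rw [coneOperator_single_of_mem h, map_zero, zero_add, Finset.sum_eq_single v₀]
      · rw [coneOperator_single_of_notMem (Finset.notMem_erase _ _), Finset.insert_erase h,
          faceSign_erase_self, mul_assoc, faceSign_mul_self, mul_one]
      · intro v hv hne
        exact coneOperator_single_of_mem (Finset.mem_erase.2 ⟨hne.symm, h⟩) _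
      · exact fun h' => absurd h h'
    · rw [coneOperator_single_of_notMem h, boundary_single_eq_sum, Finset.sum_insert h,
        Finset.erase_insert h, faceSign_insert_self, mul_assoc, faceSign_mul_self, mul_one,
        add_assoc, ← Finset.sum_add_distrib, Finset.sum_eq_zero, add_zero]
      intro v hv
      have hne : v₀ ≠ v := fun h' => h (h' ▸ hv)
      rw [coneOperator_single_of_notMem fun h' => h (Finset.mem_of_mem_erase h'),
        ← Finset.erase_insert_of_ne hne, ← Finsupp.single_add, mul_assoc, mul_assoc,
        faceSign_mul_faceSign_insert h hv]
      simp

theorem coneOperator_mem_chains {c : Finset V →₀ ℤ} {n : ℕ}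
    (hc : ∀ F ∈ c.support, IsStarFace X v₀ F ∧ F.card = n) :
    coneOperator v₀ c ∈ chains X (n + 1) := by
  rw [coneOperator, Finsupp.linearCombination_apply]
  refine Submodule.sum_mem _ fun F hF => Submodule.smul_mem _ _ ?_
  split_ifs with h
  · exact zero_mem _
  · refine Finsupp.single_mem_supported ℤ _ ⟨Or.inr (hc F hF).1.insert_mem, ?_⟩
    rw [Finset.card_insert_of_notMem h, (hc F hF).2]

/-- Values of the cone operator are combinations of simplices that contain the apex. -/
theorem coneOperator_apply_of_notMem (c : Finset V →₀ ℤ) {F : Finset V} (h : v₀ ∉ F) :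
    coneOperator v₀ c F = 0 := by
  induction c using Finsupp.induction_linear with
  | zero => simp
  | add f g hf hg => rw [map_add, Finsupp.add_apply, hf, hg, add_zero]
  | single G a =>
    by_cases hG : v₀ ∈ G
    · rw [coneOperator_single_of_mem hG, Finsupp.zero_apply]
    · rw [coneOperator_single_of_notMem hG, Finsupp.single_eq_of_ne]
      rintro rfl
      exact h (Finset.mem_insert_self _ _)

/-- A boundary does not involve the faces outside the closed star, which are maximal. -/
theorem boundary_apply_of_mem (hS : IsShell X v₀ S) {n : ℕ} {c : Finset V →₀ ℤ}
    (hc : c ∈ chains X n) {F : Finset V} (hF : F ∈ S) : boundary V c F = 0 := by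
  rw [boundary, Finsupp.linearCombination_apply, Finsupp.sum, Finsupp.finsetSum_apply]
  refine Finset.sum_eq_zero fun G hG => ?_
  rw [Finsupp.smul_apply, Finsupp.finsetSum_apply, Finset.sum_eq_zero, smul_zero]
  intro v hv
  rw [Finsupp.single_eq_of_ne]
  rintro rfl
  rcases (hc hG).1 with rfl | hGX
  · simp at hv
  · have := hS.eq_of_subset hF hGX (Finset.erase_subset v G)
    exact Finset.notMem_erase v G (this.symm ▸ hv)

/-- The coefficients of an `i`-cycle at the `i`-faces outside the closed star. -/
noncomputable def shellCoefficients (X : PreAbstractSimplicialComplex V) (S : Set (Finset V))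
    (i : ℕ) : reducedCycles X i →ₗ[ℤ] ({F ∈ S | F.card = i + 1} → ℤ) where
  toFun c F := (c : Finset V →₀ ℤ) F
  map_add' _ _ := rfl
  map_smul' _ _ := rfl

theorem ker_shellCoefficients (hS : IsShell X v₀ S) (i : ℕ) :
    LinearMap.ker (shellCoefficients X S i) =
      (boundaries X i).submoduleOf (reducedCycles X i) := by
  ext ⟨c, hc⟩
  rw [LinearMap.mem_ker]
  change _ ↔ c ∈ boundaries X i
  constructor
  · intro h
    refine ⟨coneOperator v₀ c, coneOperator_mem_chains fun F hF => ?_, ?_⟩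
    · obtain ⟨hFX, hcard⟩ := hc.1 hF
      refine ⟨?_, hcard⟩
      by_contra hs
      have hFX : F ∈ X.faces := hFX.resolve_left fun h' => by simp [h'] at hcard
      exact Finsupp.mem_support_iff.1 hF
        (congrFun h ⟨F, (hS.mem_iff F).2 ⟨hFX, hs⟩, hcard⟩)
    · have := boundary_coneOperator_add v₀ c
      rwa [LinearMap.mem_ker.1 hc.2, map_zero, add_zero] at this
  · rintro ⟨b, hb, hbc⟩
    ext ⟨F, hF, -⟩
    change c F = 0
    rw [show c = boundary V b from hbc.symm]
    exact boundary_apply_of_mem hS hb hF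

/-- A face `F` outside the closed star becomes a cycle when the cone over its boundary is
subtracted. -/
theorem exists_cycle (hS : IsShell X v₀ S) {i : ℕ} {F : Finset V} (hF : F ∈ S)
    (hcard : F.card = i + 1) :
    ∃ c ∈ reducedCycles X i, ∀ G ∈ S, c G = Finsupp.single F (1 : ℤ) G := by
  have hFX := hS.mem_faces hF
  refine ⟨Finsupp.single F 1 - coneOperator v₀ (boundary V (Finsupp.single F 1)),
    ⟨sub_mem (Finsupp.single_mem_supported ℤ _ ⟨Or.inr hFX, hcard⟩)
      (coneOperator_mem_chains fun G hG => ?_), ?_⟩, fun G hG => ?_⟩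
  · rw [boundary_single_eq_sum] at hG
    obtain ⟨v, hv, hGv⟩ := Finset.mem_biUnion.1 (Finsupp.support_finsetSum hG)
    obtain rfl := Finset.mem_singleton.1 (Finsupp.support_single_subset hGv)
    exact ⟨hS.isStarFace_of_ssubset F hF _ (Finset.erase_ssubset hv),
      by rw [Finset.card_erase_of_mem hv, hcard, Nat.add_sub_cancel]⟩
  · have := boundary_coneOperator_add v₀ (boundary V (Finsupp.single F 1))
    rw [boundary_boundary, map_zero, add_zero] at this
    rw [SetLike.mem_coe, LinearMap.mem_ker, map_sub, this, sub_self]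
  · have hvG : v₀ ∉ G := fun h =>
      hS.not_isStarFace hG ⟨G, hS.mem_faces hG, h, subset_rfl⟩
    rw [Finsupp.sub_apply, coneOperator_apply_of_notMem _ hvG, sub_zero]

theorem shellCoefficients_surjective (hS : IsShell X v₀ S) (hfin : S.Finite) (i : ℕ) :
    Function.Surjective (shellCoefficients X S i) := by
  classical
  have : Finite {F ∈ S | F.card = i + 1} := (hfin.subset (Set.sep_subset _ _)).to_subtype
  cases nonempty_fintype {F ∈ S | F.card = i + 1}
  rw [← LinearMap.range_eq_top, ← top_le_iff, ← (Pi.basisFun ℤ _).span_eq, Submodule.span_le]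
  rintro _ ⟨⟨F, hF, hcard⟩, rfl⟩
  obtain ⟨c, hc, hcF⟩ := exists_cycle hS hF hcard
  refine ⟨⟨c, hc⟩, ?_⟩
  ext ⟨G, hG, hGcard⟩
  rw [Pi.basisFun_apply]
  change c G = _
  rw [hcF G hG, Finsupp.single_apply, Pi.single_apply]
  simp only [Subtype.mk.injEq, eq_comm]

theorem reducedHomology_free_finite_finrank (hS : IsShell X v₀ S) (hfin : S.Finite) (i : ℕ) :
    Module.Free ℤ (ReducedHomology X i) ∧ Module.Finite ℤ (ReducedHomology X i) ∧
      Module.finrank ℤ (ReducedHomology X i) = {F ∈ S | F.card = i + 1}.ncard := by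
  have : Finite {F ∈ S | F.card = i + 1} := (hfin.subset (Set.sep_subset _ _)).to_subtype
  cases nonempty_fintype {F ∈ S | F.card = i + 1}
  let e : ReducedHomology X i ≃ₗ[ℤ] ({F ∈ S | F.card = i + 1} → ℤ) :=
    (Submodule.quotEquivOfEq _ _ (ker_shellCoefficients hS i).symm).trans
      ((shellCoefficients X S i).quotKerEquivOfSurjective (shellCoefficients_surjective hS hfin i))
  refine ⟨Module.Free.of_equiv e.symm, Module.Finite.equiv e.symm, ?_⟩
  rw [e.finrank_eq, Module.finrank_pi, ← Nat.card_eq_fintype_card, Nat.card_coe_set_eq]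

end Quota

theorem mainTheorem1 {V : Type*} (w : V → ℝ) (hw : ∀ v, 0 < w v) (q : ℝ)
    (hfin : (Quota.quotaComplex w q hw).faces.Finite)
    (vmin : V) (hvmin : {vmin} ∈ (Quota.quotaComplex w q hw).faces)
    (hmin : ∀ v, {v} ∈ (Quota.quotaComplex w q hw).faces → w vmin ≤ w v) :
    -- the quotient map `|X| → |X| / A`, with `A` the closed star, is a homotopy equivalence
    (∃ e : ContinuousMap.HomotopyEquiv
        (Quota.realization (Quota.quotaComplex w q hw))
        (Quota.Collapse (Quota.closedStar (Quota.quotaComplex w q hw) vmin)),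
      ∀ x, e x = Quota.collapseMap (Quota.closedStar (Quota.quotaComplex w q hw) vmin) x) ∧
    -- `|X| / A` is a bouquet with one sphere of dimension `|F| - 1` for each shell face `F`
    (∃ h : Quota.Collapse (Quota.closedStar (Quota.quotaComplex w q hw) vmin) ≃ₜ
        Quota.Bouquet (fun F : Quota.shellFaces w q hw vmin => (F : Finset V).card - 1),
      ∀ x ∈ Quota.closedStar (Quota.quotaComplex w q hw) vmin,
        h (Quota.collapseMap _ x) = Quota.Bouquet.base _) ∧
    -- reduced homology is free abelian of the stated finite rank, for any ordering of the vertices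
    (∀ [LinearOrder V], ∀ i : ℕ,
      Module.Free ℤ (Quota.ReducedHomology (Quota.quotaComplex w q hw) i) ∧
      Module.Finite ℤ (Quota.ReducedHomology (Quota.quotaComplex w q hw) i) ∧
      Module.finrank ℤ (Quota.ReducedHomology (Quota.quotaComplex w q hw) i) =
        {F ∈ Quota.shellFaces w q hw vmin | F.card = i + 1}.ncard) := by
  have hS := Quota.isShell_shellFaces w q hw vmin hmin
  have hSfin : (Quota.shellFaces w q hw vmin).Finite := hfin.subset fun _ hF => hF.1
  refine ⟨?_, Quota.exists_homeomorph_collapse_closedStar hS hfin hvmin,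
    fun i => Quota.reducedHomology_free_finite_finrank hS hSfin i⟩
  refine Quota.exists_homotopyEquiv_collapse_closedStar (T := hSfin.toFinset) ?_
  rwa [hSfin.coe_toFinset]
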